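/- Consider a one-good Cournot competition with $n\ge 2$ firms, each with marginal cost $\alpha>0$, in which firm $i$ producing quantity $x_i$ has utility $u_i(\mathbf x)=\frac{x_i}{\sum_k x_k}-\alpha x_i$, and the gradient ascent (GA) dynamics with step size $\eta$, in which all firms update simultaneously by $x_i\leftarrow x_i+\eta\,\frac{\partial u_i}{\partial x_i}(\mathbf x)$. At a symmetric point $(x,\dots,x)$ with $x>0$ one GA step yields the symmetric point $(f(x),\dots,f(x))$, where $$f(x)=x+\eta\left(\frac{n-1}{n^2x}-\alpha\right).$$ If $\eta\ge \frac{3(n-1)}{n^2\alpha^2}$, then the one-dimensional dynamical system given by $f$ is Li-Yorke chaotic. That is, there is a compact set $X\subset(0,\infty)$ with $f(X)\subseteq X$, on which $f$ is continuous, such that (i) for every integer $k\ge 1$ there is a point of $X$ that is periodic under $f$ with least period $k$; and (ii) there is an uncountable set $S\subseteq X$ such that for all $x\ne x'$ in $S$, $$\liminf_{t\to\infty}|f^t(x)-f^t(x')|=0<\limsup_{t\to\infty}|f^t(x)-f^t(x')|.$$ -/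

import Mathlib

noncomputable section

/-- Utility of firm `i` in a one-good Cournot competition with isoelastic demand (total revenue
normalised to `1`) and marginal cost `α`, as a function of the quantities `x`:
`u_i(x) = x_i / ∑ₖ x_k - α x_i`. -/
def firmUtility {n : ℕ} (α : ℝ) (i : Fin n) (x : Fin n → ℝ) : ℝ :=
  x i / (∑ k, x k) - α * x i

/-- Partial derivative of the utility of firm `i` with respect to its own quantity `x_i`. -/
def ownGradient {n : ℕ} (α : ℝ) (i : Fin n) (x : Fin n → ℝ) : ℝ :=
  deriv (fun z : ℝ => firmUtility α i (Function.update x i z)) (x i)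

/-- One simultaneous step of gradient ascent with step size `η`:
`x_i ↦ x_i + η ∂u_i/∂x_i (x)` for every firm `i`. -/
def gradientAscent {n : ℕ} (α η : ℝ) (x : Fin n → ℝ) : Fin n → ℝ :=
  fun i => x i + η * ownGradient α i x

/-- The one-dimensional update rule `x ↦ x + η ((n - 1) / (n² x) - α)`. -/
def symmetricGA (n : ℕ) (α η : ℝ) (x : ℝ) : ℝ :=
  x + η * (((n : ℝ) - 1) / ((n : ℝ) ^ 2 * x) - α)

/-- `S` is scrambled for `f`: any two distinct points of `S` have
`liminf |f^t x - f^t x'| = 0 < limsup |f^t x - f^t x'|` as `t → ∞`. -/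
def IsScrambled (f : ℝ → ℝ) (S : Set ℝ) : Prop :=
  ∀ x ∈ S, ∀ x' ∈ S, x ≠ x' →
    Filter.liminf (fun t : ℕ => |f^[t] x - f^[t] x'|) Filter.atTop = 0 ∧
    0 < Filter.limsup (fun t : ℕ => |f^[t] x - f^[t] x'|) Filter.atTop

/-- The dynamical system given by the continuous rule `f : X → X` on the compact set `X ⊆ ℝ` is
Li-Yorke chaotic. Periods are least periods. Since `X` is compact and invariant, the sequences
in `IsScrambled` are bounded for points of `X`. -/
structure IsLiYorkeChaoticOn (f : ℝ → ℝ) (X : Set ℝ) : Prop where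
  isCompact : IsCompact X
  continuousOn : ContinuousOn f X
  mapsTo : Set.MapsTo f X X
  periodic : ∀ k : ℕ, 1 ≤ k → ∃ x ∈ X, Function.minimalPeriod f x = k
  scrambled : ∃ S : Set ℝ, S ⊆ X ∧ ¬ S.Countable ∧ IsScrambled f S

end

/-!
In the coordinate `w` with `x = (m / α) w`, `m = (n - 1) / n²`, the update rule becomes
`w ↦ w + l (1 / w - 1)` (`normalizedGA l`) with `l = η α² / m`, and the hypothesis on `η` says
`3 ≤ l`. At `l = 3` a cycle of period three is born: with `v` a root of `w³ - 6 w² + 9 w - 3`, it is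
`v ↦ A ↦ u ↦ v`, where `v < u < A`. For `l ≥ 3`, keep `v` and `u` and let `A` be the image of `v`;
then `u` is mapped to the left of `v` and `A` to the right of `u` (`exists_coveringPoints`).
Therefore the image of `[v, u]` covers `[v, A]` and the image of `[u, A]` covers `[v, u]`, through
explicit inverse branches, the two roots of a quadratic equation
(`CoveringPoints.mapsTo_lower_branch`, `CoveringPoints.mapsTo_upper_branch`). For large `l` the map leaves `(0, ∞)` between `u` and `A`, so
the invariant set `X` is not an interval: it consists of the points whose whole orbit stays in
`[v, A]`.

A point of least period `k ≥ 2` is a fixed point of a composition of `k - 1` lower branches and one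
upper branch (`exists_minimalPeriod_eq`).

For the scrambled set, every sequence of visits to `[v, u]` and `[u, A]` without two consecutive
visits to `[u, A]` is realised by an orbit (`exists_itinerary`). A code `s : ℕ → Bool` prescribes
visits to `[u, A]` at some of the times `(j + 1)²`, each bit governing infinitely many of them. Two
steps within `[v, u]` expand the distance to the fixed point `1` by a factor `3 / 2`, so that an orbit
at the start of a long stay in `[v, u]` is close to `1` (`CoveringPoints.abs_sub_one_le_pow`). Just
after a late square any two coded orbits are both close to `1`; at a square where their bits differ
one is beyond `u > 1` and the other is close to `1`.
-/

open Set Filter Function Topology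

/-! ### Orbits with a prescribed itinerary -/

/-- Closedness needs continuity on the sets `J t` only, as an orbit is followed only as long as it
stays in them. -/
theorem isClosed_itinerary {f : ℝ → ℝ} {J : ℕ → Set ℝ} (hf : ∀ t, ContinuousOn f (J t))
    (hJ : ∀ t, IsClosed (J t)) (n : ℕ) : IsClosed {x | ∀ i ≤ n, f^[i] x ∈ J i} := by
  induction n generalizing J with
  | zero => simpa using hJ 0
  | succ n ih =>
    have h := (hf 0).preimage_isClosed_of_isClosed (hJ 0)
      (ih (J := fun t => J (t + 1)) (fun t => hf _) (fun t => hJ _))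
    convert h using 1
    ext x
    constructor
    · intro hx
      exact ⟨hx 0 (Nat.zero_le _), fun i hi => hx (i + 1) (by omega)⟩
    · rintro ⟨h0, h1⟩ i hi
      cases i with
      | zero => exact h0
      | succ i => exact h1 i (by omega)

theorem exists_finite_itinerary {f : ℝ → ℝ} {J : ℕ → Set ℝ} (hne : ∀ t, (J t).Nonempty)
    (hs : ∀ t, SurjOn f (J t) (J (t + 1))) (n : ℕ) : {x | ∀ i ≤ n, f^[i] x ∈ J i}.Nonempty := by
  induction n generalizing J with
  | zero => simpa using hne 0
  | succ n ih =>
    obtain ⟨y, hy⟩ := ih (J := fun t => J (t + 1)) (fun t => hne _) (fun t => hs _)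
    obtain ⟨x, hx, rfl⟩ := hs 0 (hy 0 (Nat.zero_le _))
    refine ⟨x, fun i hi => ?_⟩
    cases i with
    | zero => exact hx
    | succ i => exact hy i (by omega)

/-- If each compact set of a sequence is covered by the image of its predecessor, then some orbit
runs through the whole sequence. -/
theorem exists_itinerary {f : ℝ → ℝ} {J : ℕ → Set ℝ} (hf : ∀ t, ContinuousOn f (J t))
    (hJ : ∀ t, IsCompact (J t)) (hne : ∀ t, (J t).Nonempty)
    (hs : ∀ t, SurjOn f (J t) (J (t + 1))) : ∃ x, ∀ t, f^[t] x ∈ J t := by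
  have hcl := isClosed_itinerary hf (fun t => (hJ t).isClosed)
  obtain ⟨x, hx⟩ := IsCompact.nonempty_iInter_of_sequence_nonempty_isCompact_isClosed
    (fun n => {x | ∀ i ≤ n, f^[i] x ∈ J i}) (fun n x hx i hi => hx i (by omega))
    (exists_finite_itinerary hne hs)
    ((hJ 0).of_isClosed_subset (hcl 0) fun x hx => hx 0 le_rfl) hcl
  exact ⟨x, fun t => mem_iInter.1 hx t t le_rfl⟩

theorem isCompact_setOf_forall_iterate_mem {f : ℝ → ℝ} {K : Set ℝ} (hK : IsCompact K)
    (hf : ContinuousOn f K) : IsCompact {x | ∀ t, f^[t] x ∈ K} := by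
  refine hK.of_isClosed_subset ?_ fun x hx => hx 0
  have : {x | ∀ t, f^[t] x ∈ K} = ⋂ n, {x | ∀ i ≤ n, f^[i] x ∈ K} := by
    ext x
    simp only [mem_ofPred_eq, mem_iInter]
    exact ⟨fun h n i _ => h i, fun h t => h t t le_rfl⟩
  rw [this]
  exact isClosed_iInter (isClosed_itinerary (fun _ => hf) fun _ => hK.isClosed)

/-! ### Periodic points -/

theorem exists_fixedPoint_of_mapsTo {g : ℝ → ℝ} {a b : ℝ} (hab : a ≤ b)
    (hg : ContinuousOn g (Icc a b)) (hm : MapsTo g (Icc a b) (Icc a b)) :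
    ∃ x ∈ Icc a b, g x = x := by
  obtain ⟨x, hx, h⟩ := exists_mem_Icc_isFixedPt_of_mapsTo hg hab hm
  exact ⟨x, hx, h⟩

theorem iterate_apply_iterate_of_leftInvOn {f g : ℝ → ℝ} {K : Set ℝ} (hg : MapsTo g K K)
    (h : LeftInvOn f g K) {x : ℝ} (hx : x ∈ K) {i m : ℕ} (him : i ≤ m) :
    f^[i] (g^[m] x) = g^[m - i] x := by
  induction i with
  | zero => simp
  | succ i ih =>
    obtain ⟨r, rfl⟩ : ∃ r, m = r + (i + 1) := ⟨m - (i + 1), by omega⟩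
    rw [iterate_succ_apply', ih (by omega), show r + (i + 1) - i = r + 1 by omega,
      iterate_succ_apply', h (hg.iterate r hx), Nat.add_sub_cancel]

/-- The least period of a point of `[u, A]` that spends the rest of a period in `[v, u]` is the
length of that period, as the common endpoint `u` leaves `[v, u]` within two steps. Such points
are fixed points of compositions of the two inverse branches `g₀`, `g₁`. -/
theorem exists_minimalPeriod_eq {f g₀ g₁ : ℝ → ℝ} {v u A : ℝ} (hvu : v < u) (huA : u < A)
    (hc₀ : Continuous g₀) (hc₁ : Continuous g₁)
    (hg₀ : MapsTo g₀ (Icc v A) (Icc v u)) (hg₁ : MapsTo g₁ (Icc v u) (Icc u A))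
    (hl₀ : LeftInvOn f g₀ (Icc v A)) (hl₁ : LeftInvOn f g₁ (Icc v u))
    (hfu : f u ≤ v) (hfv : f v = A) {k : ℕ} (hk : 1 ≤ k) :
    ∃ x, (∀ t, f^[t] x ∈ Icc v A) ∧ minimalPeriod f x = k := by
  have hsub₀ : Icc v u ⊆ Icc v A := Icc_subset_Icc_right huA.le
  have hsub₁ : Icc u A ⊆ Icc v A := Icc_subset_Icc_left hvu.le
  have hmaps : MapsTo g₀ (Icc v A) (Icc v A) := hg₀.mono_right hsub₀
  obtain rfl | ⟨m, rfl⟩ : k = 1 ∨ ∃ m, k = m + 2 := by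
    rcases Nat.lt_or_ge k 2 with h | h
    · left; omega
    · right; exact ⟨k - 2, by omega⟩
  · obtain ⟨x, hx, hgx⟩ := exists_fixedPoint_of_mapsTo hvu.le hc₀.continuousOn
      (hg₀.mono_left hsub₀)
    have hfx : IsFixedPt f x := by
      have := hl₀ (hsub₀ hx)
      rwa [hgx] at this
    exact ⟨x, fun t => by rw [hfx.iterate t]; exact hsub₀ hx,
      minimalPeriod_eq_one_iff_isFixedPt.2 hfx⟩
  · have hm : MapsTo g₀^[m + 1] (Icc v A) (Icc v u) := by
      rw [iterate_succ']
      exact hg₀.comp (hmaps.iterate m)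
    obtain ⟨x, hx, hgx⟩ := exists_fixedPoint_of_mapsTo (g := g₁ ∘ g₀^[m + 1]) huA.le
      (hc₁.comp (hc₀.iterate _)).continuousOn ((hg₁.comp hm).mono_left hsub₁)
    have hxA := hsub₁ hx
    have hfx : f x = g₀^[m + 1] x := by
      have := hl₁ (hm hxA)
      rwa [← comp_apply (f := g₁), hgx] at this
    have horb : ∀ i ≤ m + 1, f^[i + 1] x = g₀^[m + 1 - i] x := fun i hi => by
      rw [iterate_succ_apply, hfx, iterate_apply_iterate_of_leftInvOn hmaps hl₀ hxA hi]
    have hI₀ : ∀ i, 1 ≤ i → i < m + 2 → f^[i] x ∈ Icc v u := fun i h1 h2 => by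
      obtain ⟨r, rfl⟩ : ∃ r, i = r + 1 := ⟨i - 1, by omega⟩
      rw [horb r (by omega)]
      obtain ⟨q, hq⟩ : ∃ q, m + 1 - r = q + 1 := ⟨m - r, by omega⟩
      rw [hq, iterate_succ_apply']
      exact hg₀ (hmaps.iterate q hxA)
    have hper : IsPeriodicPt f (m + 2) x := by
      have := horb (m + 1) le_rfl
      simpa [IsPeriodicPt, IsFixedPt] using this
    have hpos : 0 < minimalPeriod f x := hper.minimalPeriod_pos (by omega)
    refine ⟨x, fun t => ?_, ?_⟩
    · rw [← hper.iterate_mod_apply t]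
      have hlt : t % (m + 2) < m + 2 := Nat.mod_lt _ (by omega)
      rcases Nat.eq_zero_or_pos (t % (m + 2)) with h | h
      · rw [h]; exact hxA
      · exact hsub₀ (hI₀ _ h hlt)
    · by_contra hne
      have hlt : minimalPeriod f x < m + 2 :=
        lt_of_le_of_ne (hper.minimalPeriod_le (by omega)) hne
      -- A return before time `m + 2` puts `x` into both intervals.
      have hxu : x = u := by
        have := hI₀ _ hpos hlt
        rw [iterate_minimalPeriod] at this
        exact le_antisymm this.2 hx.1
      subst hxu
      have h1 := hI₀ 1 le_rfl (by omega)
      have h2 : f^[2] x = A := by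
        have : f x = v := le_antisymm hfu h1.1
        rw [iterate_succ_apply, iterate_one, this, hfv]
      rcases Nat.eq_zero_or_pos m with rfl | hm0
      · have := hper.eq
        rw [h2] at this
        exact huA.ne' this
      · have := (hI₀ 2 (by omega) (by omega)).2
        rw [h2] at this
        exact absurd this (not_le.2 huA)

/-! ### The normalised map and its period-three orbit -/

/-- The update rule in the coordinate that places the positive fixed point of `symmetricGA` at
`1`; the single remaining parameter is `l = η α² n² / (n - 1)`. -/
noncomputable def normalizedGA (l w : ℝ) : ℝ := w + l * (1 / w - 1)

/-- A point `v` of the period-three orbit of `normalizedGA 3`. Its cycle is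
`v ↦ v² - 5 v + 6 ↦ 4 v - v² ↦ v`. -/
theorem exists_root_period_three_cubic :
    ∃ v : ℝ, 0.46 < v ∧ v < 0.47 ∧ v ^ 3 - 6 * v ^ 2 + 9 * v - 3 = 0 := by
  have hc : ContinuousOn (fun v : ℝ => v ^ 3 - 6 * v ^ 2 + 9 * v - 3) (Icc 0.46 0.47) := by
    fun_prop
  obtain ⟨v, hv, h⟩ := intermediate_value_Ioo (by norm_num) hc
    (show (0 : ℝ) ∈ Ioo _ _ by constructor <;> norm_num)
  exact ⟨v, hv.1, hv.2, h⟩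

theorem continuousOn_normalizedGA (l : ℝ) : ContinuousOn (normalizedGA l) (Ioi 0) := by
  intro x hx
  have : x ≠ 0 := ne_of_gt hx
  unfold normalizedGA
  fun_prop (disch := assumption)

theorem mul_normalizedGA_sub (l y : ℝ) {w : ℝ} (hw : w ≠ 0) :
    w * (normalizedGA l w - y) = w ^ 2 - (l + y) * w + l := by
  unfold normalizedGA
  field_simp
  ring

theorem normalizedGA_sub_one (l : ℝ) {w : ℝ} (hw : w ≠ 0) :
    normalizedGA l w - 1 = (w - 1) * (1 - l / w) := by
  unfold normalizedGA
  field_simp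
  ring

/-- The covering relations between `[v, u]` and `[u, A]`, `A = normalizedGA l v`, for `l ≥ 3`.
The map inequalities are not strict because the points chosen in `exists_coveringPoints` form a
cycle of period three when `l = 3`. The numerical bounds place the fixed point `1` between `v` and
`u` and make it repelling within `[v, u]`. -/
structure CoveringPoints (l v u A : ℝ) : Prop where
  three_le : 3 ≤ l
  pos : 0 < v
  lt_one : v < 1
  le_u : 1.6 ≤ u
  u_le : u ≤ 1.66
  u_lt : u < A
  map_v : normalizedGA l v = A
  map_u : normalizedGA l u ≤ v
  map_A : u ≤ normalizedGA l A

theorem exists_coveringPoints {l : ℝ} (hl : 3 ≤ l) : ∃ v u A, CoveringPoints l v u A := by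
  obtain ⟨v, hv1, hv2, hv⟩ := exists_root_period_three_cubic
  norm_num at hv1 hv2
  have hv0 : 0 < v := by linarith
  have hinv : 3 * (1 / v) = v ^ 2 - 6 * v + 9 := by
    field_simp
    linarith
  obtain ⟨c, hc⟩ : ∃ c, c = 1 / v - 1 := ⟨_, rfl⟩
  obtain ⟨t, rfl⟩ : ∃ t, l = 3 + t := ⟨l - 3, by ring⟩
  have ht : 0 ≤ t := by linarith
  have hc3 : 3 * c = v ^ 2 - 6 * v + 6 := by rw [hc]; linarith
  have hc1 : 1.12 ≤ c := by norm_num; nlinarith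
  have hc2 : c ≤ 1.2 := by norm_num; nlinarith
  obtain ⟨a, ha⟩ : ∃ a, a = v ^ 2 - 5 * v + 6 := ⟨_, rfl⟩
  obtain ⟨u, hu⟩ : ∃ u, u = 4 * v - v ^ 2 := ⟨_, rfl⟩
  have ha1 : 3.86 ≤ a := by norm_num; nlinarith
  have hu1 : 1.6 ≤ u := by norm_num; nlinarith
  have hu2 : u ≤ 1.66 := by norm_num; nlinarith
  norm_num at hc1 hc2 ha1 hu1 hu2
  have hA : normalizedGA (3 + t) v = a + t * c := by
    unfold normalizedGA
    rw [← hc, ha]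
    linarith
  have htc : 0 ≤ t * c := by positivity
  have hu0 : 0 < u := by linarith
  have hA0 : 0 < a + t * c := by linarith
  -- The cycle equations for `u ↦ v` and `a ↦ u`: the cubic is a factor of each.
  have hcu : u ^ 2 - (3 + v) * u + 3 = 0 := by
    rw [hu]; linear_combination (v - 1) * hv
  have hca : a ^ 2 - (3 + u) * a + 3 = 0 := by
    rw [hu, ha]; linear_combination (2 * v - 7) * hv
  refine ⟨v, u, a + t * c, hl, hv0, by linarith, by norm_num; linarith, by norm_num; linarith,
    by linarith, hA, ?_, ?_⟩
  · have h := mul_normalizedGA_sub (3 + t) v hu0.ne'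
    have : u * (normalizedGA (3 + t) u - v) ≤ 0 := by rw [h]; nlinarith
    nlinarith
  · have h := mul_normalizedGA_sub (3 + t) u hA0.ne'
    have h1 : 0 ≤ c * (c - 1) := by nlinarith
    -- The linear coefficient in `t = l - 3` of `A² - (l + u) A + l`.
    have h2 : 0 ≤ 2 * a * c - a - (3 + u) * c + 1 := by nlinarith
    have : 0 ≤ (a + t * c) * (normalizedGA (3 + t) (a + t * c) - u) := by
      rw [h]
      have e : (a + t * c) ^ 2 - (3 + t + u) * (a + t * c) + (3 + t) =
          t * (2 * a * c - a - (3 + u) * c + 1) + t ^ 2 * (c * (c - 1)) := by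
        linear_combination hca
      rw [e]
      positivity
    have := nonneg_of_mul_nonneg_right this hA0
    linarith

/-! ### Inverse branches -/

/-- The inverse branches of `normalizedGA l`: the roots `w` of `w² - (l + y) w + l`, the smaller
one for `e = -1` and the larger one for `e = 1`. -/
noncomputable def branch (l e y : ℝ) : ℝ := (l + y + e * √((l + y) ^ 2 - 4 * l)) / 2

theorem continuous_branch (l e : ℝ) : Continuous (branch l e) := by
  unfold branch
  fun_prop

namespace CoveringPoints

variable {l v u A : ℝ}

theorem v_lt_u (h : CoveringPoints l v u A) : v < u := by
  have := h.le_u; have := h.lt_one; norm_num at *; linarith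

theorem u_pos (h : CoveringPoints l v u A) : 0 < u := h.pos.trans h.v_lt_u

theorem quadratic_u_nonpos (h : CoveringPoints l v u A) {y : ℝ} (hy : v ≤ y) :
    u ^ 2 - (l + y) * u + l ≤ 0 := by
  rw [← mul_normalizedGA_sub l y h.u_pos.ne']
  exact mul_nonpos_of_nonneg_of_nonpos h.u_pos.le (by linarith [h.map_u])

theorem discrim_nonneg (h : CoveringPoints l v u A) {y : ℝ} (hy : v ≤ y) :
    0 ≤ (l + y) ^ 2 - 4 * l := by
  nlinarith [h.quadratic_u_nonpos hy, sq_nonneg (2 * u - (l + y))]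

/-- The point `u` lies between the two roots of `w² - (l + y) w + l`. -/
theorem abs_two_mul_u_sub_le (h : CoveringPoints l v u A) {y : ℝ} (hy : v ≤ y) :
    |2 * u - (l + y)| ≤ √((l + y) ^ 2 - 4 * l) := by
  apply Real.abs_le_sqrt
  nlinarith [h.quadratic_u_nonpos hy]

theorem normalizedGA_branch (h : CoveringPoints l v u A) {e y : ℝ} (he : e ^ 2 = 1) (hy : v ≤ y) :
    normalizedGA l (branch l e y) = y := by
  have hs := Real.sq_sqrt (h.discrim_nonneg hy)
  have hq : branch l e y ^ 2 - (l + y) * branch l e y + l = 0 := by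
    unfold branch
    linear_combination (1 / 4) * e ^ 2 * hs + (1 / 4) * ((l + y) ^ 2 - 4 * l) * he
  have hb : branch l e y ≠ 0 := by
    intro hb
    rw [hb] at hq
    linarith [h.three_le]
  have := mul_normalizedGA_sub l y hb
  rw [hq] at this
  exact sub_eq_zero.1 ((mul_eq_zero.1 this).resolve_left hb)

theorem mapsTo_lower_branch (h : CoveringPoints l v u A) :
    MapsTo (branch l (-1)) (Icc v A) (Icc v u) := by
  intro y hy
  have hu := abs_le.1 (h.abs_two_mul_u_sub_le hy.1)
  have hv : 0 ≤ v ^ 2 - (l + y) * v + l := by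
    rw [← mul_normalizedGA_sub l y h.pos.ne', h.map_v]
    exact mul_nonneg h.pos.le (by linarith [hy.2])
  have hvy : √((l + y) ^ 2 - 4 * l) ≤ |2 * v - (l + y)| := by
    rw [← Real.sqrt_sq_eq_abs]
    exact Real.sqrt_le_sqrt (by nlinarith)
  rw [abs_of_nonpos (by linarith [h.three_le, h.lt_one, hy.1])] at hvy
  unfold branch
  constructor <;> linarith

theorem mapsTo_upper_branch (h : CoveringPoints l v u A) :
    MapsTo (branch l 1) (Icc v u) (Icc u A) := by
  intro y hy
  have hu := abs_le.1 (h.abs_two_mul_u_sub_le hy.1)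
  have hA0 : 0 < A := h.u_pos.trans h.u_lt
  have hA : 0 ≤ A ^ 2 - (l + y) * A + l := by
    rw [← mul_normalizedGA_sub l y hA0.ne']
    exact mul_nonneg hA0.le (by linarith [hy.2, h.map_A])
  have hAy : √((l + y) ^ 2 - 4 * l) ≤ |2 * A - (l + y)| := by
    rw [← Real.sqrt_sq_eq_abs]
    exact Real.sqrt_le_sqrt (by nlinarith)
  have := h.u_lt
  unfold branch
  rcases abs_cases (2 * A - (l + y)) with ⟨e, _⟩ | ⟨e, _⟩ <;> rw [e] at hAy <;>
    constructor <;> linarith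

theorem exists_minimalPeriod (h : CoveringPoints l v u A) {k : ℕ} (hk : 1 ≤ k) :
    ∃ x, (∀ t, (normalizedGA l)^[t] x ∈ Icc v A) ∧ minimalPeriod (normalizedGA l) x = k :=
  exists_minimalPeriod_eq h.v_lt_u h.u_lt (continuous_branch l (-1)) (continuous_branch l 1)
    h.mapsTo_lower_branch h.mapsTo_upper_branch
    (fun _ hy => h.normalizedGA_branch (by norm_num) hy.1)
    (fun _ hy => h.normalizedGA_branch (by norm_num) hy.1) h.map_u h.map_v hk

/-! ### Repulsion from the fixed point -/

/-- Two steps inside `[v, u]` push points away from the fixed point `1` by a definite factor: the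
steps multiply the distance by `l / w - 1`, which is at least `2` on the left of `1` and at least
`0.8` on `[1, u]`, and the two sides alternate. -/
theorem abs_sub_one_le (h : CoveringPoints l v u A) {w : ℝ} (hw : w ∈ Icc v u)
    (hw' : normalizedGA l w ∈ Icc v u) :
    |w - 1| ≤ 2 / 3 * |normalizedGA l (normalizedGA l w) - 1| := by
  have hu := h.u_le
  norm_num at hu
  have hl := h.three_le
  have key : ∀ z ∈ Icc v u, 0.8 ≤ l / z - 1 ∧ (z ≤ 1 → 2 ≤ l / z - 1) := by
    intro z hz
    have hz0 : 0 < z := h.pos.trans_le hz.1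
    constructor
    · rw [le_sub_iff_add_le, le_div_iff₀ hz0]
      norm_num
      linarith [hz.2]
    · intro hz1
      rw [le_sub_iff_add_le, le_div_iff₀ hz0]
      linarith
  have hw0 : w ≠ 0 := (h.pos.trans_le hw.1).ne'
  have hw0' : normalizedGA l w ≠ 0 := (h.pos.trans_le hw'.1).ne'
  obtain ⟨k1, k2⟩ := key w hw
  obtain ⟨k3, k4⟩ := key _ hw'
  norm_num at k1 k3
  have e := normalizedGA_sub_one l hw0
  have hprod : 3 / 2 ≤ (l / w - 1) * (l / normalizedGA l w - 1) := by
    rcases le_total w 1 with h1 | h1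
    · nlinarith [k2 h1]
    · have : normalizedGA l w ≤ 1 := by nlinarith
      nlinarith [k4 this]
  have e2 : normalizedGA l (normalizedGA l w) - 1 =
      (w - 1) * ((l / w - 1) * (l / normalizedGA l w - 1)) := by
    rw [normalizedGA_sub_one l hw0', e]
    ring
  rw [e2, abs_mul, abs_of_nonneg (a := (l / w - 1) * _) (by linarith)]
  nlinarith [abs_nonneg (w - 1)]

/-- A point that stays in `[v, u]` for a long time is close to the fixed point `1`. -/
theorem abs_sub_one_le_pow (h : CoveringPoints l v u A) (m : ℕ) {w : ℝ}
    (hw : ∀ i ≤ 2 * m, (normalizedGA l)^[i] w ∈ Icc v u) : |w - 1| ≤ (2 / 3) ^ m := by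
  induction m generalizing w with
  | zero =>
    have h0 := hw 0 le_rfl
    have := h.u_le
    have := h.pos
    norm_num at *
    rw [abs_le]
    constructor <;> linarith
  | succ m ih =>
    have h1 := h.abs_sub_one_le (hw 0 (by omega)) (hw 1 (by omega))
    have h2 := ih (w := normalizedGA l (normalizedGA l w)) fun i hi => hw (i + 2) (by omega)
    rw [iterate_zero_apply] at h1
    rw [pow_succ]
    linarith

end CoveringPoints

/-! ### The scrambled set -/

/-- The times at which the orbit with code `s` visits `[u, A]`. Every bit of `s` is recorded at
infinitely many squares, and the gaps between consecutive squares are unbounded. -/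
def IsMarked (s : ℕ → Bool) (t : ℕ) : Prop := ∃ j, t = (j + 1) ^ 2 ∧ s j.unpair.1 = true

theorem not_isMarked_of_lt_of_lt (s : ℕ → Bool) {j t : ℕ} (h1 : (j + 1) ^ 2 < t)
    (h2 : t < (j + 2) ^ 2) : ¬ IsMarked s t := by
  rintro ⟨i, rfl, -⟩
  have := lt_of_pow_lt_pow_left₀ 2 (by omega) h1
  have := lt_of_pow_lt_pow_left₀ 2 (by omega) h2
  omega

theorem isMarked_sq_iff (s : ℕ → Bool) (j : ℕ) :
    IsMarked s ((j + 1) ^ 2) ↔ s j.unpair.1 = true := by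
  constructor
  · rintro ⟨i, hi, h⟩
    have := Nat.pow_left_injective (n := 2) (by omega) hi
    obtain rfl : j = i := by omega
    exact h
  · exact fun h => ⟨j, rfl, h⟩

open Classical in
/-- The interval in which the orbit with code `s` lies at time `t`. -/
noncomputable def codedInterval (v u A : ℝ) (s : ℕ → Bool) (t : ℕ) : Set ℝ :=
  if IsMarked s t then Icc u A else Icc v u

namespace CoveringPoints

variable {l v u A : ℝ}

theorem codedInterval_subset (h : CoveringPoints l v u A) (s : ℕ → Bool) (t : ℕ) :
    codedInterval v u A s t ⊆ Icc v A := by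
  unfold codedInterval
  split_ifs
  · exact Icc_subset_Icc_left h.v_lt_u.le
  · exact Icc_subset_Icc_right h.u_lt.le

theorem Icc_subset_Ioi (h : CoveringPoints l v u A) : Icc v A ⊆ Ioi 0 :=
  fun _ hx => h.pos.trans_le hx.1

theorem surjOn_codedInterval (h : CoveringPoints l v u A) (s : ℕ → Bool) (t : ℕ) :
    SurjOn (normalizedGA l) (codedInterval v u A s t) (codedInterval v u A s (t + 1)) := by
  intro y hy
  by_cases ht : IsMarked s t
  · have ht' : ¬ IsMarked s (t + 1) := by
      obtain ⟨j, rfl, -⟩ := ht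
      exact not_isMarked_of_lt_of_lt s (j := j) (by omega) (by ring_nf; omega)
    simp only [codedInterval, ht, ht', if_true, if_false] at hy ⊢
    exact ⟨_, h.mapsTo_upper_branch hy, h.normalizedGA_branch (by norm_num) hy.1⟩
  · have hy' := h.codedInterval_subset s _ hy
    simp only [codedInterval, ht, if_false]
    exact ⟨_, h.mapsTo_lower_branch hy', h.normalizedGA_branch (by norm_num) hy'.1⟩

theorem exists_coded_orbit (h : CoveringPoints l v u A) (s : ℕ → Bool) :
    ∃ x, ∀ t, (normalizedGA l)^[t] x ∈ codedInterval v u A s t := by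
  refine exists_itinerary (fun t => (continuousOn_normalizedGA l).mono
    ((h.codedInterval_subset s t).trans h.Icc_subset_Ioi)) (fun t => ?_) (fun t => ?_)
    (h.surjOn_codedInterval s)
  · unfold codedInterval
    split_ifs <;> exact isCompact_Icc
  · unfold codedInterval
    split_ifs
    · exact nonempty_Icc.2 h.u_lt.le
    · exact nonempty_Icc.2 h.v_lt_u.le

theorem abs_iterate_sub_one_le (h : CoveringPoints l v u A) {s : ℕ → Bool} {x : ℝ}
    (hx : ∀ t, (normalizedGA l)^[t] x ∈ codedInterval v u A s t) {t m : ℕ}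
    (hm : ∀ i ≤ 2 * m, ¬ IsMarked s (t + i)) :
    |(normalizedGA l)^[t] x - 1| ≤ (2 / 3) ^ m := by
  refine h.abs_sub_one_le_pow m fun i hi => ?_
  have := hx (i + t)
  rwa [codedInterval, if_neg (by rw [add_comm]; exact hm i hi), iterate_add_apply] at this

/-- Just after a square both orbits start a long run in `[v, u]`, hence are close to `1`. -/
theorem frequently_abs_sub_lt (h : CoveringPoints l v u A) {s s' : ℕ → Bool} {x x' : ℝ}
    (hx : ∀ t, (normalizedGA l)^[t] x ∈ codedInterval v u A s t)
    (hx' : ∀ t, (normalizedGA l)^[t] x' ∈ codedInterval v u A s' t) {ε : ℝ} (hε : 0 < ε) :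
    ∃ᶠ t in atTop, |(normalizedGA l)^[t] x - (normalizedGA l)^[t] x'| < ε := by
  rw [frequently_atTop]
  intro N
  obtain ⟨m, hm⟩ := exists_pow_lt_of_lt_one (half_pos hε) (show (2 / 3 : ℝ) < 1 by norm_num)
  obtain ⟨j, hjm, hjN⟩ : ∃ j, m ≤ j ∧ N ≤ j := ⟨max m N, le_max_left _ _, le_max_right _ _⟩
  have run : ∀ r : ℕ → Bool, ∀ i ≤ 2 * m, ¬ IsMarked r ((j + 1) ^ 2 + 1 + i) := fun r i hi =>
    not_isMarked_of_lt_of_lt r (j := j) (by omega) (by nlinarith)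
  have h1 := h.abs_iterate_sub_one_le hx (run s)
  have h2 := h.abs_iterate_sub_one_le hx' (run s')
  refine ⟨(j + 1) ^ 2 + 1, by nlinarith, ?_⟩
  rw [abs_le] at h1 h2
  rw [abs_lt]
  constructor <;> linarith

/-- At the squares recording a bit in which the codes differ, one orbit lies beyond `u` and the
other, at the start of a long run in `[v, u]`, is close to `1`. -/
theorem frequently_le_abs_sub (h : CoveringPoints l v u A) {s s' : ℕ → Bool} {x x' : ℝ}
    (hx : ∀ t, (normalizedGA l)^[t] x ∈ codedInterval v u A s t)
    (hx' : ∀ t, (normalizedGA l)^[t] x' ∈ codedInterval v u A s' t) (hs : s ≠ s') :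
    ∃ᶠ t in atTop, 1 / 10 ≤ |(normalizedGA l)^[t] x - (normalizedGA l)^[t] x'| := by
  obtain ⟨b, hb⟩ := Function.ne_iff.1 hs
  wlog hbt : s b = true ∧ s' b = false generalizing s s' x x'
  · simp_rw [abs_sub_comm ((normalizedGA l)^[_] x)]
    refine this hx' hx hs.symm hb.symm ?_
    cases h1 : s b <;> cases h2 : s' b <;> simp_all
  rw [frequently_atTop]
  intro N
  obtain ⟨j, hj⟩ : ∃ j, j = Nat.pair b (max 2 N) := ⟨_, rfl⟩
  have hj1 : j.unpair.1 = b := by rw [hj, Nat.unpair_pair]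
  have hj2 : 2 ≤ j := hj ▸ (le_max_left 2 N).trans (Nat.right_le_pair _ _)
  have hjN : N ≤ j := hj ▸ (le_max_right 2 N).trans (Nat.right_le_pair _ _)
  have run : ∀ i ≤ 2 * 2, ¬ IsMarked s' ((j + 1) ^ 2 + i) := fun i hi => by
    rcases Nat.eq_zero_or_pos i with rfl | hi0
    · rw [add_zero, isMarked_sq_iff, hj1, hbt.2]
      exact Bool.false_ne_true
    · exact not_isMarked_of_lt_of_lt s' (j := j) (by omega) (by nlinarith)
  have h1 := h.abs_iterate_sub_one_le hx' run
  have h2 := hx ((j + 1) ^ 2)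
  rw [codedInterval, if_pos ((isMarked_sq_iff s j).2 (hj1 ▸ hbt.1))] at h2
  refine ⟨(j + 1) ^ 2, by nlinarith, ?_⟩
  have hu := h.le_u
  norm_num at hu h1
  rw [abs_le] at h1
  exact le_trans (by linarith [h2.1]) (le_abs_self _)

end CoveringPoints

theorem liminf_eq_zero_and_limsup_pos {d : ℕ → ℝ} (h0 : ∀ t, 0 ≤ d t) {C δ : ℝ}
    (hC : ∀ t, d t ≤ C) (hlow : ∀ ε > 0, ∃ᶠ t in atTop, d t < ε) (hδ : 0 < δ)
    (hhigh : ∃ᶠ t in atTop, δ ≤ d t) : liminf d atTop = 0 ∧ 0 < limsup d atTop := by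
  have hb : IsBoundedUnder (· ≤ ·) atTop d := isBoundedUnder_of ⟨C, hC⟩
  have hb' : IsBoundedUnder (· ≥ ·) atTop d := isBoundedUnder_of ⟨0, h0⟩
  refine ⟨le_antisymm (le_of_forall_pos_le_add fun ε hε => ?_) ?_, hδ.trans_le ?_⟩
  · rw [zero_add]
    exact liminf_le_of_frequently_le ((hlow ε hε).mono fun _ => le_of_lt) hb'
  · exact le_liminf_of_le hb.isCoboundedUnder_ge (Eventually.of_forall h0)
  · exact le_limsup_of_frequently_le hhigh hb

theorem exists_isLiYorkeChaoticOn_normalizedGA {l : ℝ} (hl : 3 ≤ l) :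
    ∃ X ⊆ Ioi 0, IsLiYorkeChaoticOn (normalizedGA l) X := by
  obtain ⟨v, u, A, h⟩ := exists_coveringPoints hl
  have hcont := (continuousOn_normalizedGA l).mono h.Icc_subset_Ioi
  have hsub : {x | ∀ t, (normalizedGA l)^[t] x ∈ Icc v A} ⊆ Icc v A := fun x hx => hx 0
  refine ⟨{x | ∀ t, (normalizedGA l)^[t] x ∈ Icc v A}, hsub.trans h.Icc_subset_Ioi,
    isCompact_setOf_forall_iterate_mem isCompact_Icc hcont, hcont.mono hsub,
    fun x hx t => hx (t + 1), fun k hk => h.exists_minimalPeriod hk, ?_⟩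
  choose x hx using h.exists_coded_orbit
  have hxX : ∀ s t, (normalizedGA l)^[t] (x s) ∈ Icc v A := fun s t =>
    h.codedInterval_subset s t (hx s t)
  have hinj : Injective x := by
    intro s s' hss
    by_contra hne
    obtain ⟨t, ht⟩ := (h.frequently_le_abs_sub (hx s) (hx s') hne).exists
    rw [hss, sub_self, abs_zero] at ht
    norm_num at ht
  refine ⟨range x, range_subset_iff.2 hxX, fun hc => ?_, ?_⟩
  · rw [← image_univ] at hc
    have := countable_univ_iff.1 (countable_of_injective_of_countable_image hinj.injOn hc)
    obtain ⟨g, hg⟩ := exists_surjective_nat (ℕ → Bool)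
    obtain ⟨k, hk⟩ := hg fun k => !(g k k)
    exact (Bool.eq_not_self _).1 (congr_fun hk k)
  · rintro _ ⟨s, rfl⟩ _ ⟨s', rfl⟩ hne
    exact liminf_eq_zero_and_limsup_pos (fun t => abs_nonneg _)
      (fun t => Real.dist_le_of_mem_Icc (hxX s t) (hxX s' t))
      (fun ε hε => h.frequently_abs_sub_lt (hx s) (hx s') hε) (by norm_num : (0 : ℝ) < 1 / 10)
      (h.frequently_le_abs_sub (hx s) (hx s') (fun e => hne (by rw [e])))

/-! ### Rescaling to the Cournot dynamics -/

/-- Boundedness of the orbits is needed for `liminf` and `limsup` of reals to be scaled by `c`. -/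
theorem IsScrambled.image_mul {f g : ℝ → ℝ} {c : ℝ} (hc : 0 < c)
    (hfg : Semiconj (c * ·) g f) {X S : Set ℝ} (hX : IsCompact X) (hm : MapsTo g X X)
    (hSX : S ⊆ X) (hS : IsScrambled g S) : IsScrambled f ((c * ·) '' S) := by
  rintro _ ⟨x, hx, rfl⟩ _ ⟨y, hy, rfl⟩ hne
  obtain ⟨h1, h2⟩ := hS x hx y hy fun e => hne (by rw [e])
  have e : (fun t : ℕ => |f^[t] (c * x) - f^[t] (c * y)|) =
      (c * ·) ∘ fun t : ℕ => |g^[t] x - g^[t] y| := by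
    ext t
    have : ∀ z, c * g^[t] z = f^[t] (c * z) := (hfg.iterate_right t).eq
    rw [comp_apply, ← this, ← this, ← mul_sub, abs_mul, abs_of_pos hc]
  obtain ⟨C, hC⟩ := hX.isBounded.exists_norm_le
  have hb : IsBoundedUnder (· ≤ ·) atTop fun t : ℕ => |g^[t] x - g^[t] y| :=
    isBoundedUnder_of ⟨C + C, fun t => (abs_sub _ _).trans
      (add_le_add (hC _ (hm.iterate t (hSX hx))) (hC _ (hm.iterate t (hSX hy))))⟩
  have hb' : IsBoundedUnder (· ≥ ·) atTop fun t : ℕ => |g^[t] x - g^[t] y| :=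
    isBoundedUnder_of ⟨0, fun t => abs_nonneg _⟩
  have hmono : Monotone (c * · : ℝ → ℝ) := fun a b hab => mul_le_mul_of_nonneg_left hab hc.le
  have hcont : Continuous (c * · : ℝ → ℝ) := by fun_prop
  have e1 := hmono.map_liminf_of_continuousAt _ hcont.continuousAt hb.isCoboundedUnder_ge hb'
  have e2 := hmono.map_limsup_of_continuousAt _ hcont.continuousAt hb hb'.isCoboundedUnder_le
  simp only at e1 e2 ⊢
  rw [e, ← e1, ← e2, h1]
  exact ⟨mul_zero c, mul_pos hc h2⟩

theorem IsLiYorkeChaoticOn.image_mul {f g : ℝ → ℝ} {c : ℝ} (hc : 0 < c)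
    (hfg : Semiconj (c * ·) g f) {X : Set ℝ} (h : IsLiYorkeChaoticOn g X) :
    IsLiYorkeChaoticOn f ((c * ·) '' X) := by
  have hcont : Continuous (c * · : ℝ → ℝ) := by fun_prop
  have hinj : Injective (c * · : ℝ → ℝ) := mul_right_injective₀ hc.ne'
  refine ⟨h.isCompact.image hcont, ?_, ?_, fun k hk => ?_, ?_⟩
  · have e : f = (c * ·) ∘ g ∘ (c⁻¹ * ·) := by
      ext y
      have := hfg.eq (c⁻¹ * y)
      simp only [mul_inv_cancel_left₀ hc.ne'] at this
      exact this.symm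
    rw [e]
    refine hcont.comp_continuousOn (h.continuousOn.comp (by fun_prop) ?_)
    rintro _ ⟨x, hx, rfl⟩
    simpa only [inv_mul_cancel_left₀ hc.ne'] using hx
  · rintro _ ⟨x, hx, rfl⟩
    exact ⟨g x, h.mapsTo hx, hfg.eq x⟩
  · obtain ⟨x, hx, rfl⟩ := h.periodic k hk
    refine ⟨c * x, mem_image_of_mem _ hx, ?_⟩
    refine minimalPeriod_eq_minimalPeriod_iff.2 fun n => ?_
    have : c * g^[n] x = f^[n] (c * x) := (hfg.iterate_right n).eq x
    rw [IsPeriodicPt, IsPeriodicPt, IsFixedPt, IsFixedPt, ← this]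
    exact hinj.eq_iff
  · obtain ⟨S, hSX, hS, hscr⟩ := h.scrambled
    exact ⟨(c * ·) '' S, image_mono hSX, 
      fun hcnt => hS (countable_of_injective_of_countable_image hinj.injOn hcnt),
      hscr.image_mul hc hfg h.isCompact h.mapsTo hSX⟩

theorem ownGradient_const {n : ℕ} (hn : 0 < n) (α : ℝ) (i : Fin n) {x : ℝ} (hx : 0 < x) :
    ownGradient α i (fun _ => x) = ((n : ℝ) - 1) / ((n : ℝ) ^ 2 * x) - α := by
  have hn0 : (n : ℝ) ≠ 0 := by positivity
  have hsum : ∀ z : ℝ, ∑ k, update (fun _ : Fin n => x) i z k = z + ((n : ℝ) - 1) * x := by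
    intro z
    rw [Finset.sum_update_of_mem (Finset.mem_univ i)]
    simp [Finset.card_sdiff, Nat.cast_sub (show 1 ≤ n from hn)]
  have hne : x + ((n : ℝ) - 1) * x ≠ 0 := by
    have : x + ((n : ℝ) - 1) * x = n * x := by ring
    rw [this]
    positivity
  have hd := ((hasDerivAt_id x).div ((hasDerivAt_id x).add_const (((n : ℝ) - 1) * x)) hne).sub
    ((hasDerivAt_id x).const_mul α)
  unfold ownGradient firmUtility
  simp only [hsum, update_self]
  refine hd.deriv.trans ?_
  have : x + ((n : ℝ) - 1) * x = n * x := by ring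
  simp only [id, this]
  field_simp

theorem theorem2 (n : ℕ) (hn : 2 ≤ n) (α : ℝ) (hα : 0 < α) (η : ℝ)
    (hη : 3 * ((n : ℝ) - 1) / ((n : ℝ) ^ 2 * α ^ 2) ≤ η) :
    (∀ x : ℝ, 0 < x →
      gradientAscent α η (fun _ : Fin n => x) = fun _ : Fin n => symmetricGA n α η x) ∧
    ∃ X : Set ℝ, X ⊆ Set.Ioi 0 ∧ IsLiYorkeChaoticOn (symmetricGA n α η) X := by
  refine ⟨fun x hx => ?_, ?_⟩
  · ext i
    simp only [gradientAscent, symmetricGA, ownGradient_const (by omega) α i hx]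
  have hn2 : (2 : ℝ) ≤ n := by exact_mod_cast hn
  obtain ⟨m, hm⟩ : ∃ m, m = ((n : ℝ) - 1) / (n : ℝ) ^ 2 := ⟨_, rfl⟩
  have hm0 : 0 < m := by rw [hm]; exact div_pos (by linarith) (by positivity)
  have hl : 3 ≤ η * α ^ 2 / m := by
    rw [div_le_iff₀ (by positivity)] at hη
    rw [le_div_iff₀ hm0, hm, mul_div_assoc', div_le_iff₀ (by positivity)]
    linarith
  have hc : 0 < m / α := div_pos hm0 hα
  have hfg : Semiconj (m / α * ·) (normalizedGA (η * α ^ 2 / m)) (symmetricGA n α η) := by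
    intro w
    have e : symmetricGA n α η (m / α * w) =
        m / α * w + η * (m / (m / α * w) - α) := by
      rw [symmetricGA, ← div_div, ← hm]
    rw [e, normalizedGA]
    -- At `w = 0` both sides take the junk value `1 / 0 = 0`.
    rcases eq_or_ne w 0 with rfl | hw
    · simp only [mul_zero, div_zero]
      field_simp
      ring
    · field_simp
  obtain ⟨X, hX, h⟩ := exists_isLiYorkeChaoticOn_normalizedGA hl
  refine ⟨_, ?_, h.image_mul hc hfg⟩
  rintro _ ⟨x, hx, rfl⟩
  exact mul_pos hc (hX hx)
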